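/- **Corollary (Depth Scaling for Regular Languages).** Let $L$ be a regular language over a finite alphabet $\Sigma$, let $\$\notin\Sigma$, and let layer norm be either standard layer norm or RMS norm. For every $d\in\mathbb N$ there is a causally masked $d$-layer transformer $T$ (as defined below, with no positional encoding) that, on every string $w\$$ with $w\in\Sigma^*$ of length $|w\$| = |w|+1$ at most $2^{(d-9)/4}+1$, recognizes whether $w\in L$. The same transformer $T$ does so in exact real arithmetic and with logarithmic precision: for every adequate family of datatypes $(\mathbb D_p)_{p\in\mathbb N}$ there is a constant $c>0$ such that, for every such $w$ and every $p\ge c\log_2(|w|+2)$, $T$ recognizes whether $w\in L$ when all of its arithmetic is carried out in $\mathbb D_p$. *Transformers.* The vocabulary is $\Sigma$ together with three further tokens: the end marker $\$$, a beginning-of-sequence token $\mathrm{BoS}$ and an answer token "accept". A $d$-layer transformer has $h\ge1$ heads, model dimension $m$ divisible by $h$, and feedforward width $\omega$, all finite and arbitrary, and has rational parameters: embeddings $\mathbf E(\sigma)\in\mathbb Q^m$, a positional encoding $\pi:\mathbb N\to\mathbb Q^m$, $d$ layers, each consisting of a self-attention sublayer followed by a feedforward sublayer, and an unembedding $\mathbf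 U$ giving one logit per token. On $x_1\cdots x_n=\mathrm{BoS}\,w\,\$$ (so $n=|w|+2$) the residual stream starts as $\mathbf h_i=\mathbf E(x_i)+\pi(i)$; "no positional encoding" means $\pi=0$. Each sublayer has a mask $\boldsymbol\mu\in\mathbb Q^m$, reads $\mathbf z_i=\mathrm{layer\_norm}(\boldsymbol\mu\odot\mathbf h_i)$, and replaces $\mathbf h_i$ by $\mathbf h_i+\delta_i$. Here, without trainable gain or bias, standard layer norm divides $x-\mathrm{mean}(x)$ by the standard deviation of the entries of $x$, RMS norm divides $x$ by the root mean square of its entries, and the value is $0$ where the denominator is $0$. - Self-attention (causal, averaging-hard): each head $k$ has queries $\mathbf q_i=\mathbf Q^k\mathbf z_i$, keys $\mathbf k_i=\mathbf K^k\mathbf z_i$ and values $\mathbf v_i=\mathbf V^k\mathbf z_i$ in dimension $m/h$. Its output $\mathbf a_{i,k}$ is the uniform average of $\mathbf v_j$ over those $j\le i$ that maximize $\mathbf q_i^\top\mathbf k_j$ among all $j\le i$, which is the limit of softmax attention as the temperature tends to $0$. Then $\delta_i=\mathbf W\,\mathrm{concat}(\mathbf a_{i,1},\dots,\mathbf a_{i,h})$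 with $\mathbf W\in\mathbb Q^{m\times m}$. - Feedforward: $\delta_i=\mathbf U'\,\mathrm{ReLU}(\mathbf W'\mathbf z_i)$ with $\mathbf W'\in\mathbb Q^{\omega\times m}$ and $\mathbf U'\in\mathbb Q^{m\times\omega}$. The output of the transformer is the token of maximum logit, computed from the final residual stream at the last position $n$. *$T$ recognizes whether $w\in L$* means that the maximum is attained by exactly one token and that this token is "accept" if and only if $w\in L$. *Precision.* A family of datatypes assigns to each $p\in\mathbb N$ and each string in $\{0,1\}^p$ a real number; $\mathbb D_p$ also denotes the set of the values for $p$, and $[x]_{\mathbb D_p}$ is the element of $\mathbb D_p$ closest to $x\in\mathbb R$ (the higher one in case of a tie). The family is *adequate* if $0\in\mathbb D_p$ for all $p$ and $[x]_{\mathbb D_p}\to x$ as $p\to\infty$ for every $x\in\mathbb R$. Computing in $\mathbb D_p$ means that all parameters are rounded to $\mathbb D_p$ and that every arithmetic operation returns $[\cdot]_{\mathbb D_p}$ of its exact result. The operations are: binary addition and multiplication, with inner products summed from left to right; the attention weight $1/r$, where $r$ is the number of maximizing positions; the sum over positions in an attention head, as a single operation; and layer norm $\mathbb R^m\to\mathbb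 R^m$, as a single operation rounded coordinatewise. -/

import Mathlib

open Filter Topology

/-! ## Tokens -/

/-- The vocabulary of a transformer recognizing a language over the alphabet `α`: the symbols
of `α`, and three further tokens, namely the end marker `$`, the beginning-of-sequence token,
and the answer token "accept". -/
inductive Token (α : Type*) where
  | sym (a : α) : Token α
  | eos : Token α
  | bos : Token α
  | accept : Token α

/-- The token sequence `BoS w₁ ⋯ wₙ $` that is fed to the transformer for the string `w`. -/
def inputTokens {α : Type*} (w : List α) : Fin (w.length + 2) → Token α :=
  fun i => (Token.bos :: (w.map Token.sym ++ [Token.eos])).get (i.cast (by simp))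

/-! ## Numerical datatypes -/

/-- A family of numerical datatypes `𝔻_p`: it assigns a real number to each bit string of
length `p`. -/
def BitSemantics := (p : ℕ) → (Fin p → Bool) → ℝ

namespace BitSemantics

/-- `[x]_{𝔻_p}`: the value of `𝔻_p` closest to `x`; of two equally close values, the higher. -/
noncomputable def round (D : BitSemantics) (p : ℕ) (x : ℝ) : ℝ :=
  sSup {y | y ∈ Set.range (D p) ∧ ∀ s, |y - x| ≤ |D p s - x|}

/-- The supremum in the definition of rounding is attained. -/
theorem round_isGreatest (D : BitSemantics) (p : ℕ) (x : ℝ) :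
    IsGreatest {y | y ∈ Set.range (D p) ∧ ∀ s, |y - x| ≤ |D p s - x|} (D.round p x) := by
  have hfin : {y | y ∈ Set.range (D p) ∧ ∀ s, |y - x| ≤ |D p s - x|}.Finite :=
    (Set.finite_range (D p)).subset fun y hy => hy.1
  have hne : {y | y ∈ Set.range (D p) ∧ ∀ s, |y - x| ≤ |D p s - x|}.Nonempty := by
    obtain ⟨s, hs⟩ := Finite.exists_min (fun s => |D p s - x|)
    exact ⟨D p s, ⟨s, rfl⟩, hs⟩
  exact ⟨hne.csSup_mem hfin, fun y hy => le_csSup hfin.bddAbove hy⟩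

/-- Minimal requirements on a family of datatypes: zero is representable, and every real number
is represented ever more precisely as the number `p` of bits grows. -/
structure IsAdequate (D : BitSemantics) : Prop where
  zero_mem : ∀ p, (0 : ℝ) ∈ Set.range (D p)
  tendsto_round : ∀ x : ℝ, Tendsto (fun p => D.round p x) atTop (𝓝 x)

end BitSemantics

/-! ## Arithmetic

All computations below take a function `rd : ℝ → ℝ` that is applied to the parameters and to the
result of each arithmetic operation. For `rd = id` this is exact real arithmetic; for
`rd = D.round p` every operation is `p`-precise: on representable arguments, it returns the
correctly rounded exact result. -/

/-- Iterated addition `x₀ + x₁ + ⋯ + x_{m-1}`, from left to right. -/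
def roundedSum (rd : ℝ → ℝ) {m : ℕ} (x : Fin m → ℝ) : ℝ :=
  (List.ofFn x).foldl (fun s y => rd (s + y)) 0

/-- The inner product of two vectors. -/
def roundedDot (rd : ℝ → ℝ) {m : ℕ} (x y : Fin m → ℝ) : ℝ :=
  roundedSum rd fun j => rd (x j * y j)

/-- The product of a rational parameter matrix and a vector. -/
noncomputable def roundedMulVec (rd : ℝ → ℝ) {k m : ℕ} (A : Matrix (Fin k) (Fin m) ℚ)
    (x : Fin m → ℝ) : Fin k → ℝ :=
  fun i => roundedDot rd (fun j => rd (A i j : ℝ)) x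

theorem roundedSum_id {m : ℕ} (x : Fin m → ℝ) : roundedSum id x = ∑ j, x j := by
  have h : ∀ (l : List ℝ) (a : ℝ), l.foldl (fun s y => id (s + y)) a = a + l.sum := by
    intro l
    induction l with
    | nil => intro a; simp
    | cons b l ih => intro a; rw [List.foldl_cons, ih]; simp [add_assoc]
  rw [roundedSum, h, zero_add, List.sum_ofFn]

theorem roundedMulVec_id {k m : ℕ} (A : Matrix (Fin k) (Fin m) ℚ) (x : Fin m → ℝ) :
    roundedMulVec id A x = (A.map (fun q => (q : ℝ))).mulVec x := by
  funext i
  simp [roundedMulVec, roundedDot, roundedSum_id, Matrix.mulVec, dotProduct]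

/-! ## Layer norm -/

/-- The two usual kinds of layer norm. -/
inductive NormKind where
  | standard : NormKind
  | rms : NormKind

/-- Layer norm as a function on `ℝ^m`, without trainable gain and bias: standard layer norm
`(x - mean x) / std x`, or RMS norm `x / rms x`. (A vector whose denominator is zero is mapped to
zero.) -/
noncomputable def layerNorm (κ : NormKind) {m : ℕ} (x : Fin m → ℝ) : Fin m → ℝ :=
  match κ with
  | .standard =>
      let μ := (∑ j, x j) / m
      fun i => (x i - μ) / √((∑ j, (x j - μ) ^ 2) / m)
  | .rms => fun i => x i / √((∑ j, x j ^ 2) / m)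

/-- Masked pre-norm `layer_norm (μ ⊙ h)` with a mask vector `μ`; layer norm counts as a single
operation. -/
noncomputable def maskedPreNorm (κ : NormKind) (rd : ℝ → ℝ) {m : ℕ} (mask : Fin m → ℚ)
    (h : Fin m → ℝ) : Fin m → ℝ :=
  fun i => rd (layerNorm κ (fun j => rd (rd (mask j : ℝ) * h j)) i)

/-! ## Averaging-hard attention -/

open Classical in
/-- The elements of `S` at which the score `s` is maximal. -/
noncomputable def maximizers {ι : Type*} (S : Finset ι) (s : ι → ℝ) : Finset ι :=
  S.filter fun j => ∀ l ∈ S, s l ≤ s j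

/-- The output of an averaging-hard attention head that attends to the positions in `S` with
scores `s` and values `v`: the attention weight is split uniformly across the positions of maximal
score. The sum over positions counts as a single operation. -/
noncomputable def hardAttention (rd : ℝ → ℝ) {ι : Type*} (S : Finset ι) (s : ι → ℝ) {k : ℕ}
    (v : ι → Fin k → ℝ) : Fin k → ℝ :=
  fun a => rd (∑ j ∈ maximizers S s, rd (rd (1 / ((maximizers S s).card : ℝ)) * v j a))

/-- In exact arithmetic, averaging-hard attention is the zero-temperature limit of softmax
attention. -/
theorem tendsto_softmax_hardAttention {ι : Type*} (S : Finset ι) (hS : S.Nonempty) (s : ι → ℝ)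
    {k : ℕ} (v : ι → Fin k → ℝ) (a : Fin k) :
    Tendsto (fun τ : ℝ => ∑ j ∈ S,
        Real.exp (1 / τ * s j) / (∑ l ∈ S, Real.exp (1 / τ * s l)) * v j a)
      (𝓝[>] 0) (𝓝 (hardAttention id S s v a)) := by
  classical
  obtain ⟨j₀, hj₀, hmax⟩ := S.exists_max_image s hS
  have hmem : ∀ j, j ∈ maximizers S s ↔ j ∈ S ∧ s j = s j₀ := by
    intro j
    simp only [maximizers, Finset.mem_filter]
    constructor
    · rintro ⟨hj, h⟩
      exact ⟨hj, le_antisymm (hmax j hj) (h j₀ hj₀)⟩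
    · rintro ⟨hj, h⟩
      exact ⟨hj, fun l hl => h ▸ hmax l hl⟩
  have hlim : ∀ j ∈ S, Tendsto (fun τ : ℝ => Real.exp (1 / τ * (s j - s j₀))) (𝓝[>] 0)
      (𝓝 (if j ∈ maximizers S s then 1 else 0)) := by
    intro j hj
    by_cases h : s j = s j₀
    · simp [hmem, hj, h]
    · have hlt : s j - s j₀ < 0 := sub_neg.2 (lt_of_le_of_ne (hmax j hj) h)
      have hn : j ∉ maximizers S s := fun hh => h ((hmem j).1 hh).2
      rw [if_neg hn]
      refine Real.tendsto_exp_atBot.comp ?_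
      simp only [one_div]
      exact tendsto_inv_nhdsGT_zero.atTop_mul_const_of_neg hlt
  have hsum : Tendsto (fun τ : ℝ => ∑ l ∈ S, Real.exp (1 / τ * (s l - s j₀))) (𝓝[>] 0)
      (𝓝 ((maximizers S s).card : ℝ)) := by
    have h := tendsto_finsetSum S hlim
    have hc : (∑ j ∈ S, if j ∈ maximizers S s then (1 : ℝ) else 0) = (maximizers S s).card := by
      rw [← Finset.sum_filter]
      have : S.filter (fun j => j ∈ maximizers S s) = maximizers S s := by
        ext j; simp [hmem]
      rw [this]; simp
    rwa [hc] at h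
  have hcard : ((maximizers S s).card : ℝ) ≠ 0 := by
    have : j₀ ∈ maximizers S s := (hmem j₀).2 ⟨hj₀, rfl⟩
    exact_mod_cast (Finset.card_pos.2 ⟨j₀, this⟩).ne'
  have hmain : Tendsto (fun τ : ℝ => ∑ j ∈ S, Real.exp (1 / τ * (s j - s j₀)) /
      (∑ l ∈ S, Real.exp (1 / τ * (s l - s j₀))) * v j a) (𝓝[>] 0)
      (𝓝 (∑ j ∈ S, (if j ∈ maximizers S s then (1 : ℝ) else 0) /
        ((maximizers S s).card : ℝ) * v j a)) := tendsto_finsetSum S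
    fun j hj => ((hlim j hj).div hsum hcard).mul (tendsto_const_nhds (x := v j a))
  have hval : (∑ j ∈ S, (if j ∈ maximizers S s then (1 : ℝ) else 0) /
      ((maximizers S s).card : ℝ) * v j a) = hardAttention id S s v a := by
    have : S.filter (fun j => j ∈ maximizers S s) = maximizers S s := by
      ext j; simp [hmem]
    simp only [hardAttention, id]
    conv_rhs => rw [← this, Finset.sum_filter]
    rw [this]
    refine Finset.sum_congr rfl fun j _ => ?_
    split_ifs <;> simp
  rw [hval] at hmain
  refine hmain.congr fun τ => Finset.sum_congr rfl fun j _ => ?_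
  have hfac : ∀ l, Real.exp (1 / τ * (s l - s j₀)) =
      Real.exp (1 / τ * s l) * Real.exp (-(1 / τ * s j₀)) := by
    intro l; rw [← Real.exp_add]; ring_nf
  simp only [hfac, ← Finset.sum_mul]
  rw [mul_div_mul_right _ _ (Real.exp_pos _).ne']

/-! ## Transformers -/

/-- Parameters of a self-attention sublayer with `h` heads of dimension `k`, hence model dimension
`h * k`. -/
structure AttentionSublayer (h k : ℕ) where
  mask : Fin (h * k) → ℚ
  query : Fin h → Matrix (Fin k) (Fin (h * k)) ℚ
  key : Fin h → Matrix (Fin k) (Fin (h * k)) ℚ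
  value : Fin h → Matrix (Fin k) (Fin (h * k)) ℚ
  out : Matrix (Fin (h * k)) (Fin (h * k)) ℚ

/-- Parameters of a feedforward sublayer with model dimension `m` and width `w`. -/
structure FeedforwardSublayer (m w : ℕ) where
  mask : Fin m → ℚ
  W : Matrix (Fin w) (Fin m) ℚ
  U : Matrix (Fin m) (Fin w) ℚ

/-- A `d`-layer transformer over the vocabulary `V`. The model dimension is
`heads * headDim`. -/
structure Transformer (V : Type*) (d : ℕ) where
  heads : ℕ
  heads_pos : 0 < heads
  headDim : ℕ
  width : ℕ
  embed : V → Fin (heads * headDim) → ℚ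
  pos : ℕ → Fin (heads * headDim) → ℚ
  attn : Fin d → AttentionSublayer heads headDim
  ff : Fin d → FeedforwardSublayer (heads * headDim) width
  unembed : V → Fin (heads * headDim) → ℚ

/-- The causally masked self-attention sublayer, with its residual connection: position `i`
attends to the positions `j ≤ i`. -/
noncomputable def AttentionSublayer.apply {h k : ℕ} (A : AttentionSublayer h k) (κ : NormKind)
    (rd : ℝ → ℝ) {n : ℕ} (x : Fin n → Fin (h * k) → ℝ) : Fin n → Fin (h * k) → ℝ :=
  let z : Fin n → Fin (h * k) → ℝ := fun i => maskedPreNorm κ rd A.mask (x i)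
  let q : Fin h → Fin n → Fin k → ℝ := fun r i => roundedMulVec rd (A.query r) (z i)
  let key : Fin h → Fin n → Fin k → ℝ := fun r i => roundedMulVec rd (A.key r) (z i)
  let v : Fin h → Fin n → Fin k → ℝ := fun r i => roundedMulVec rd (A.value r) (z i)
  let a : Fin n → Fin h → Fin k → ℝ := fun i r =>
    hardAttention rd (Finset.Iic i) (fun j => roundedDot rd (q r i) (key r j)) (v r)
  let concat : Fin n → Fin (h * k) → ℝ := fun i b => a i b.divNat b.modNat
  fun i b => rd (x i b + roundedMulVec rd A.out (concat i) b)

/-- The feedforward sublayer, with its residual connection, at one position. -/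
noncomputable def FeedforwardSublayer.apply {m w : ℕ} (F : FeedforwardSublayer m w) (κ : NormKind)
    (rd : ℝ → ℝ) (x : Fin m → ℝ) : Fin m → ℝ :=
  let z : Fin m → ℝ := maskedPreNorm κ rd F.mask x
  let relu : Fin w → ℝ := fun a => max 0 (roundedMulVec rd F.W z a)
  fun b => rd (x b + roundedMulVec rd F.U relu b)

namespace Transformer

variable {V : Type*} {d : ℕ}

/-- The initial residual stream; the first position has index `1` in the positional encoding. -/
noncomputable def initial (T : Transformer V d) (rd : ℝ → ℝ) {n : ℕ} (x : Fin n → V) :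
    Fin n → Fin (T.heads * T.headDim) → ℝ :=
  fun i b => rd (rd (T.embed (x i) b : ℝ) + rd (T.pos (i + 1) b : ℝ))

/-- One layer: self-attention, then feedforward. -/
noncomputable def layer (T : Transformer V d) (κ : NormKind) (rd : ℝ → ℝ) (l : Fin d) {n : ℕ}
    (x : Fin n → Fin (T.heads * T.headDim) → ℝ) : Fin n → Fin (T.heads * T.headDim) → ℝ :=
  fun i => (T.ff l).apply κ rd ((T.attn l).apply κ rd x i)

/-- The residual stream after all `d` layers. -/
noncomputable def residual (T : Transformer V d) (κ : NormKind) (rd : ℝ → ℝ) {n : ℕ}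
    (x : Fin n → V) : Fin n → Fin (T.heads * T.headDim) → ℝ :=
  (List.finRange d).foldl (fun h l => T.layer κ rd l h) (T.initial rd x)

/-- The logits, read off at the last position. -/
noncomputable def logits (T : Transformer V d) (κ : NormKind) (rd : ℝ → ℝ) {n : ℕ}
    (x : Fin (n + 1) → V) : V → ℝ :=
  fun y => roundedDot rd (T.residual κ rd x (Fin.last n)) (fun b => rd (T.unembed y b : ℝ))

/-- The transformer outputs the token `y` if `y` has maximum score; we insist that the maximum is
unique, so that no convention for breaking ties is needed. -/
def Outputs (T : Transformer V d) (κ : NormKind) (rd : ℝ → ℝ) {n : ℕ} (x : Fin (n + 1) → V)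
    (y : V) : Prop :=
  ∀ y', y' ≠ y → T.logits κ rd x y' < T.logits κ rd x y

/-- On the string `w$`, preceded by a beginning-of-sequence token, the transformer outputs a token,
and this token is "accept" if and only if `w ∈ L`. -/
def RecognizesOn {α : Type*} (T : Transformer (Token α) d) (κ : NormKind) (rd : ℝ → ℝ)
    (L : Language α) (w : List α) : Prop :=
  ∃ y, T.Outputs κ rd (inputTokens w) y ∧ (y = Token.accept ↔ w ∈ L)

end Transformer

/-! For fixed `d` only finitely many strings satisfy the length bound, and `log₂(|w| + 2) ≥ 1`. So a
large `c` forces `p` beyond any threshold that may depend on `d`, the language and the datatypes,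
and it suffices that each `w` is recognized for all large `p`. This is a limit argument
(`DFA.eventually_recognizesOn`): every intermediate quantity tends to its exact value. Exact
arithmetic is the constant sequence `id` of rounding functions. The only discontinuities are layer
norm at zero denominators, which are avoided, and the choice of maximizers, which is stable because
each head has either all scores exactly `0` or a unique maximizer.

The exact computation multiplies the transition maps of an automaton by repeated doubling
(`windowProd_apply`). Each position holds an element of `Function.End σ`; a layer fetches the
element held `2 ^ l` steps earlier and multiplies. After `d - 1` doublings the window at the last
position reaches back to BoS, whose action is constant, so clamping earlier positions to BoS is
harmless.

Fetching requires positions. Averaging a sign that is `1` at BoS and `-1` elsewhere yields `1 / (i +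
1)`, and layer norm turns `(1 / (i + 1), 1)` into the unit vector in direction `(1, i + 1)`.
Shifting by `o` is linear in this vector up to a positive factor, and the inner product singles out
the desired position (`dirX_add_mul_dirY_lt_sub`).

Parameters remain rational although layer norm takes square roots: the number of slots is a perfect
square, and masks with weights `3` and `4` make the relevant norms equal to `5`. -/

/-! ## Arithmetic with vanishing rounding errors -/

/-- A sequence of rounding functions that preserve zero and whose rounding errors vanish in the
limit, locally uniformly. -/
structure IsAsymptoticallyExact (rd : ℕ → ℝ → ℝ) : Prop where
  map_zero : ∀ p, rd p 0 = 0
  tendsto : ∀ {x : ℕ → ℝ} {a : ℝ}, Tendsto x atTop (𝓝 a) →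
    Tendsto (fun p => rd p (x p)) atTop (𝓝 a)

theorem isAsymptoticallyExact_id : IsAsymptoticallyExact fun _ => id :=
  ⟨fun _ => rfl, fun h => h⟩

/-- The rounding of the limit `a` is itself a datatype value, hence a competitor when `x p` is
rounded. The rounding error at `x p` is thus at most `|D.round p a - x p|`, and pointwise
convergence at `a` suffices. -/
theorem BitSemantics.IsAdequate.isAsymptoticallyExact {D : BitSemantics} (hD : D.IsAdequate) :
    IsAsymptoticallyExact D.round where
  map_zero p := by
    obtain ⟨s, hs⟩ := hD.zero_mem p
    have h := (D.round_isGreatest p 0).1.2 s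
    simpa [hs] using h
  tendsto {x a} hx := by
    have hclose : ∀ p, |D.round p (x p) - x p| ≤ |D.round p a - x p| := fun p => by
      obtain ⟨s, hs⟩ := (D.round_isGreatest p a).1.1
      rw [← hs]
      exact (D.round_isGreatest p (x p)).1.2 s
    have hzero : Tendsto (fun p => |D.round p a - x p|) atTop (𝓝 0) := by
      simpa using ((hD.tendsto_round a).sub hx).abs
    have hdiff : Tendsto (fun p => D.round p (x p) - x p) atTop (𝓝 0) :=
      squeeze_zero_norm hclose hzero
    simpa using hdiff.add hx

namespace IsAsymptoticallyExact

variable {rd : ℕ → ℝ → ℝ}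

theorem const (h : IsAsymptoticallyExact rd) (a : ℝ) :
    Tendsto (fun p => rd p a) atTop (𝓝 a) :=
  h.tendsto tendsto_const_nhds

theorem roundedSum (h : IsAsymptoticallyExact rd) {m : ℕ} {x : ℕ → Fin m → ℝ} {a : Fin m → ℝ}
    (hx : ∀ j, Tendsto (fun p => x p j) atTop (𝓝 (a j))) :
    Tendsto (fun p => roundedSum (rd p) (x p)) atTop (𝓝 (∑ j, a j)) := by
  have key : ∀ (m : ℕ) (x : ℕ → Fin m → ℝ) (a : Fin m → ℝ) (s : ℕ → ℝ) (b : ℝ),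
      (∀ j, Tendsto (fun p => x p j) atTop (𝓝 (a j))) → Tendsto s atTop (𝓝 b) →
      Tendsto (fun p => (List.ofFn (x p)).foldl (fun s y => rd p (s + y)) (s p)) atTop
        (𝓝 (b + ∑ j, a j)) := by
    intro m
    induction m with
    | zero => intro x a s b _ hs; simpa using hs
    | succ m ih =>
      intro x a s b hx hs
      simp only [List.ofFn_succ, List.foldl_cons, Fin.sum_univ_succ, ← add_assoc]
      exact ih (fun p j => x p j.succ) (fun j => a j.succ) _ _ (fun j => hx j.succ)
        (h.tendsto (hs.add (hx 0)))
  simpa [_root_.roundedSum] using key m x a (fun _ => 0) 0 hx tendsto_const_nhds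

theorem roundedDot (h : IsAsymptoticallyExact rd) {m : ℕ} {x y : ℕ → Fin m → ℝ}
    {a b : Fin m → ℝ} (hx : ∀ j, Tendsto (fun p => x p j) atTop (𝓝 (a j)))
    (hy : ∀ j, Tendsto (fun p => y p j) atTop (𝓝 (b j))) :
    Tendsto (fun p => roundedDot (rd p) (x p) (y p)) atTop (𝓝 (∑ j, a j * b j)) :=
  h.roundedSum fun j => h.tendsto ((hx j).mul (hy j))

theorem roundedMulVec (h : IsAsymptoticallyExact rd) {k m : ℕ} (A : Matrix (Fin k) (Fin m) ℚ)
    {x : ℕ → Fin m → ℝ} {a : Fin m → ℝ} (hx : ∀ j, Tendsto (fun p => x p j) atTop (𝓝 (a j)))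
    (i : Fin k) :
    Tendsto (fun p => roundedMulVec (rd p) A (x p) i) atTop (𝓝 (∑ j, (A i j : ℝ) * a j)) :=
  h.roundedDot (fun _ => h.const _) hx

/-- Ties between scores need not survive in a limit. Preservation of zero makes the scores of a head
with zero queries vanish exactly at every precision, which keeps uniform attention uniform. -/
theorem roundedSum_zero (h : IsAsymptoticallyExact rd) (p m : ℕ) :
    _root_.roundedSum (rd p) (fun _ : Fin m => 0) = 0 := by
  have key : ∀ l : List ℝ, (∀ y ∈ l, y = 0) → l.foldl (fun s y => rd p (s + y)) 0 = 0 := by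
    intro l
    induction l with
    | nil => simp
    | cons y l ih =>
      intro hl
      rw [List.foldl_cons, hl y (by simp), add_zero, h.map_zero]
      exact ih fun z hz => hl z (by simp [hz])
  exact key _ (by simp)

theorem roundedMulVec_zero (h : IsAsymptoticallyExact rd) (p : ℕ) {k m : ℕ} (x : Fin m → ℝ) :
    _root_.roundedMulVec (rd p) (0 : Matrix (Fin k) (Fin m) ℚ) x = 0 := by
  funext i
  simp [_root_.roundedMulVec, _root_.roundedDot, h.map_zero, h.roundedSum_zero]

theorem roundedDot_zero_left (h : IsAsymptoticallyExact rd) (p : ℕ) {m : ℕ} (y : Fin m → ℝ) :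
    _root_.roundedDot (rd p) 0 y = 0 := by
  simp [_root_.roundedDot, h.map_zero, h.roundedSum_zero]

/-- If the set of maximizing positions stabilizes, then the output of an attention head tends to
the average of the limiting values over this set. -/
theorem hardAttention (h : IsAsymptoticallyExact rd) {ι : Type*} {S T : Finset ι}
    {s : ℕ → ι → ℝ} (hT : ∀ᶠ p in atTop, maximizers S (s p) = T) {k : ℕ}
    {v : ℕ → ι → Fin k → ℝ} {a : Fin k} {b : ι → ℝ}
    (hv : ∀ j ∈ T, Tendsto (fun p => v p j a) atTop (𝓝 (b j))) :
    Tendsto (fun p => hardAttention (rd p) S (s p) (v p) a) atTop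
      (𝓝 (∑ j ∈ T, 1 / (T.card : ℝ) * b j)) := by
  have hlim : Tendsto (fun p => rd p (∑ j ∈ T, rd p (rd p (1 / (T.card : ℝ)) * v p j a))) atTop
      (𝓝 (∑ j ∈ T, 1 / (T.card : ℝ) * b j)) :=
    h.tendsto (tendsto_finsetSum T fun j hj => h.tendsto ((h.const _).mul (hv j hj)))
  refine hlim.congr' ?_
  filter_upwards [hT] with p hp
  rw [_root_.hardAttention, hp]

end IsAsymptoticallyExact

theorem maximizers_const {ι : Type*} (S : Finset ι) (b : ℝ) : maximizers S (fun _ => b) = S := by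
  simp [maximizers]

/-- A strict gap between finitely many limiting scores persists for all large `p`; this compensates
for the discontinuity of hard attention. -/
theorem eventually_maximizers_eq_singleton {ι : Type*} {S : Finset ι} {s : ℕ → ι → ℝ} {b : ι → ℝ}
    (hs : ∀ j ∈ S, Tendsto (fun p => s p j) atTop (𝓝 (b j))) {t : ι} (ht : t ∈ S)
    (hmax : ∀ j ∈ S, j ≠ t → b j < b t) : ∀ᶠ p in atTop, maximizers S (s p) = {t} := by
  have hev : ∀ᶠ p in atTop, ∀ j ∈ S, j ≠ t → s p j < s p t := by
    rw [Filter.eventually_all_finset]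
    intro j hj
    by_cases hjt : j = t
    · simp [hjt]
    · filter_upwards [(hs j hj).eventually_lt (hs t ht) (hmax j hj hjt)] with p hp _ using hp
  filter_upwards [hev] with p hp
  ext j
  simp only [maximizers, Finset.mem_filter, Finset.mem_singleton]
  constructor
  · rintro ⟨hj, hle⟩
    by_contra hjt
    exact absurd (hle t ht) (not_le.2 (hp j hj hjt))
  · rintro rfl
    refine ⟨ht, fun l hl => ?_⟩
    by_cases hlj : l = j
    · rw [hlj]
    · exact (hp l hl hlj).le

/-! ## Antisymmetric residual streams

A vector `u : S → ℝ` is stored in the residual stream together with its negation. Such a vector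
has mean zero, so that standard layer norm and RMS norm agree on it. -/

section Antisymmetric

variable {S : Type*} [Fintype S]

/-- The sign of the copy of a slot. -/
def copySign (b : Bool) : ℚ := if b then 1 else -1

/-- The size of a head that holds two copies of each slot. -/
abbrev slotDim (S : Type*) [Fintype S] : ℕ := Fintype.card (Bool × S)

/-- The coordinates of a head, as copies of slots. -/
noncomputable def headCoord : Bool × S ≃ Fin (slotDim S) := Fintype.equivFin _

/-- The coordinates of the residual stream, as copies of slots. -/
noncomputable def coord : Bool × S ≃ Fin (1 * slotDim S) :=
  headCoord.trans (finCongr (one_mul _).symm)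

theorem modNat_coord (x : Bool × S) : (coord x).modNat = headCoord x := by
  apply Fin.ext
  simp only [Fin.coe_modNat]
  exact Nat.mod_eq_of_lt (headCoord x).isLt

/-- The sequence of vectors `x` tends to the antisymmetric vector given by `u`. -/
def Represents (x : ℕ → Fin (1 * slotDim S) → ℝ) (u : S → ℝ) : Prop :=
  ∀ b c, Tendsto (fun p => x p (coord (b, c))) atTop (𝓝 ((copySign b : ℝ) * u c))

/-- The antisymmetric vector given by `u`. -/
noncomputable def antisymmetric (u : S → ℝ) : Fin (1 * slotDim S) → ℝ :=
  fun j => (copySign (coord.symm j).1 : ℝ) * u (coord.symm j).2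

theorem Represents.tendsto {x : ℕ → Fin (1 * slotDim S) → ℝ} {u : S → ℝ} (h : Represents x u)
    (j : Fin (1 * slotDim S)) : Tendsto (fun p => x p j) atTop (𝓝 (antisymmetric u j)) := by
  simpa [antisymmetric] using h (coord.symm j).1 (coord.symm j).2

theorem sum_coord (f : Bool → S → ℝ) :
    ∑ j, f (coord.symm j).1 (coord.symm j).2 = ∑ c, f true c + ∑ c, f false c := by
  rw [← coord.sum_comp (fun j => f (coord.symm j).1 (coord.symm j).2)]
  simp [Fintype.sum_prod_type]

theorem sum_antisymmetric (u : S → ℝ) : ∑ j, antisymmetric u j = 0 := by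
  rw [show ∑ j, antisymmetric u j = _ from sum_coord fun b c => (copySign b : ℝ) * u c]
  simp [copySign]

theorem sum_antisymmetric_sq (u : S → ℝ) : ∑ j, antisymmetric u j ^ 2 = 2 * ∑ c, u c ^ 2 := by
  rw [show ∑ j, antisymmetric u j ^ 2 = _ from
    sum_coord fun b c => ((copySign b : ℝ) * u c) ^ 2]
  simp [copySign]
  ring

/-- The vector `μ ⊙ u`, divided by its Euclidean norm. -/
noncomputable def normalized (mask : S → ℚ) (u : S → ℝ) : S → ℝ :=
  fun c => mask c * u c / √(∑ c, (mask c * u c) ^ 2)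

/-- A mask that is the same on both copies of a slot. -/
noncomputable def slotMask (mask : S → ℚ) : Fin (1 * slotDim S) → ℚ :=
  fun j => mask (coord.symm j).2

/-- There are `2 * K ^ 2` coordinates, with limiting mean `0` and limiting sum of squares `2 * ∑ c,
u c ^ 2`. Both denominators therefore tend to the Euclidean norm of `u` divided by the integer `K`.
Positivity of this norm makes the division continuous at the limit. -/
theorem Represents.layerNorm {x : ℕ → Fin (1 * slotDim S) → ℝ} {u : S → ℝ} (h : Represents x u)
    (κ : NormKind) (hu : 0 < ∑ c, u c ^ 2) {K : ℕ} (hK : Fintype.card S = K ^ 2) :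
    Represents (fun p => layerNorm κ (x p)) fun c => K * (u c / √(∑ c, u c ^ 2)) := by
  have hne : Nonempty S := by
    by_contra hS
    rw [not_nonempty_iff] at hS
    simp at hu
  have hKpos : 0 < K := by
    have : 0 < Fintype.card S := Fintype.card_pos
    rw [hK] at this
    exact Nat.pos_of_ne_zero fun h0 => by simp [h0] at this
  have hK0 : (0 : ℝ) < K := by exact_mod_cast hKpos
  have hdim : ((1 * slotDim S : ℕ) : ℝ) = 2 * K ^ 2 := by
    simp [slotDim, hK]
  have hν : 0 < √(∑ c, u c ^ 2) := Real.sqrt_pos.2 hu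
  have hden : √((2 * ∑ c, u c ^ 2) / (2 * K ^ 2)) = √(∑ c, u c ^ 2) / K := by
    rw [mul_div_mul_left _ _ two_ne_zero, Real.sqrt_div hu.le, Real.sqrt_sq hK0.le]
  have hden0 : √(∑ c, u c ^ 2) / K ≠ 0 := (div_pos hν hK0).ne'
  intro b c
  have hval : (copySign b : ℝ) * (K * (u c / √(∑ c, u c ^ 2))) =
      (copySign b : ℝ) * u c / (√(∑ c, u c ^ 2) / K) := by
    field_simp
  rw [hval]
  cases κ with
  | standard =>
    have hmean : Tendsto (fun p => (∑ j, x p j) / ((1 * slotDim S : ℕ) : ℝ)) atTop (𝓝 0) := by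
      have := (tendsto_finsetSum Finset.univ fun j _ => h.tendsto j).div_const
        ((1 * slotDim S : ℕ) : ℝ)
      rwa [sum_antisymmetric, zero_div] at this
    have hsq : Tendsto (fun p => √((∑ j, (x p j - (∑ j, x p j) / ((1 * slotDim S : ℕ) : ℝ)) ^ 2)
        / ((1 * slotDim S : ℕ) : ℝ))) atTop (𝓝 (√(∑ c, u c ^ 2) / K)) := by
      have := ((tendsto_finsetSum Finset.univ fun j _ =>
        ((h.tendsto j).sub hmean).pow 2).div_const ((1 * slotDim S : ℕ) : ℝ)).sqrt
      simpa only [sub_zero, sum_antisymmetric_sq, hdim, hden] using this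
    have := ((h b c).sub hmean).div hsq hden0
    rwa [sub_zero] at this
  | rms =>
    have hsq : Tendsto (fun p => √((∑ j, x p j ^ 2) / ((1 * slotDim S : ℕ) : ℝ))) atTop
        (𝓝 (√(∑ c, u c ^ 2) / K)) := by
      have := ((tendsto_finsetSum Finset.univ fun j _ =>
        (h.tendsto j).pow 2).div_const ((1 * slotDim S : ℕ) : ℝ)).sqrt
      simpa only [sum_antisymmetric_sq, hdim, hden] using this
    exact (h b c).div hsq hden0

variable {rd : ℕ → ℝ → ℝ}

theorem Represents.maskedPreNorm {x : ℕ → Fin (1 * slotDim S) → ℝ} {u : S → ℝ}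
    (h : Represents x u) (hrd : IsAsymptoticallyExact rd) (κ : NormKind) {mask : S → ℚ}
    (hu : 0 < ∑ c, (mask c * u c) ^ 2) {K : ℕ} (hK : Fintype.card S = K ^ 2) :
    Represents (fun p => maskedPreNorm κ (rd p) (slotMask mask) (x p))
      fun c => K * normalized mask u c := by
  have hm : Represents (fun p j => rd p (rd p (slotMask mask j : ℝ) * x p j))
      fun c => mask c * u c := by
    intro b c
    have := hrd.tendsto ((hrd.const (mask c : ℝ)).mul (h b c))
    simpa [slotMask, mul_left_comm] using this
  intro b c
  exact hrd.tendsto (hm.layerNorm κ hu hK b c)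

/-- A matrix that reads off linear combinations of the entries of a normalized vector, when the
normalization carries a factor `K`. -/
noncomputable def readMatrix (K : ℕ) {w : ℕ} (A : Fin w → S → ℚ) :
    Matrix (Fin w) (Fin (1 * slotDim S)) ℚ :=
  fun a j => if (coord.symm j).1 then A a (coord.symm j).2 / K else 0

/-- Only the positive copy of each slot is read, and the entries `A a c / K` cancel the factor `K`
from layer norm while staying rational. -/
theorem Represents.readMatrix {x : ℕ → Fin (1 * slotDim S) → ℝ} {u : S → ℝ}
    (h : Represents x u) (hrd : IsAsymptoticallyExact rd) (κ : NormKind) {mask : S → ℚ}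
    (hu : 0 < ∑ c, (mask c * u c) ^ 2) {K : ℕ} (hK : Fintype.card S = K ^ 2) {w : ℕ}
    (A : Fin w → S → ℚ) (a : Fin w) :
    Tendsto (fun p => roundedMulVec (rd p) (readMatrix K A)
      (_root_.maskedPreNorm κ (rd p) (slotMask mask) (x p)) a) atTop
      (𝓝 (∑ c, (A a c : ℝ) * normalized mask u c)) := by
  have hK0 : (K : ℝ) ≠ 0 := by
    intro h0
    have : IsEmpty S := Fintype.card_eq_zero_iff.1 (by
      rw [hK, Nat.cast_eq_zero.1 h0, zero_pow two_ne_zero])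
    simp at hu
  have := hrd.roundedMulVec (_root_.readMatrix K A)
    (h.maskedPreNorm hrd κ hu hK).tendsto a
  convert this using 2
  have hs := sum_coord (S := S) fun b c =>
    (((if b then A a c / K else 0 : ℚ) : ℝ) * ((copySign b : ℝ) * (K * normalized mask u c)))
  refine Eq.trans ?_ hs.symm
  simp only [copySign, if_true, Bool.false_eq_true, if_false, Rat.cast_zero, zero_mul,
    Finset.sum_const_zero, add_zero]
  refine Finset.sum_congr rfl fun c _ => ?_
  push_cast
  field_simp

/-! ### Feedforward sublayers -/

/-- The feedforward sublayer with neurons `Ω` that read the linear combinations `A` and write the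
vectors `B`. -/
noncomputable def slotFeedforward {Ω : Type*} [Fintype Ω] (K : ℕ) (mask : S → ℚ)
    (A B : Ω → S → ℚ) : FeedforwardSublayer (1 * slotDim S) (Fintype.card Ω) where
  mask := slotMask mask
  W := readMatrix K fun a => A ((Fintype.equivFin Ω).symm a)
  U := fun j a => copySign (coord.symm j).1 * B ((Fintype.equivFin Ω).symm a) (coord.symm j).2

theorem Represents.slotFeedforward {x : ℕ → Fin (1 * slotDim S) → ℝ} {u : S → ℝ}
    (h : Represents x u) (hrd : IsAsymptoticallyExact rd) (κ : NormKind) {mask : S → ℚ}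
    (hu : 0 < ∑ c, (mask c * u c) ^ 2) {K : ℕ} (hK : Fintype.card S = K ^ 2)
    {Ω : Type*} [Fintype Ω] (A B : Ω → S → ℚ) :
    Represents (fun p => (slotFeedforward K mask A B).apply κ (rd p) (x p))
      fun c => u c + ∑ a, B a c * max 0 (∑ c', (A a c' : ℝ) * normalized mask u c') := by
  intro b c
  have hrelu : ∀ a : Fin (Fintype.card Ω), _ := fun a =>
    (tendsto_const_nhds (x := (0 : ℝ))).max
      (h.readMatrix hrd κ hu hK (fun a => A ((Fintype.equivFin Ω).symm a)) a)
  have := hrd.tendsto ((h b c).add (hrd.roundedMulVec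
    (_root_.slotFeedforward K mask A B).U hrelu (coord (b, c))))
  refine Eq.subst (motive := fun L => Tendsto _ atTop (𝓝 L)) (Eq.symm ?_) this
  rw [mul_add, Finset.mul_sum]
  congr 1
  rw [← (Fintype.equivFin Ω).symm.sum_comp]
  simp [_root_.slotFeedforward, mul_assoc]

/-! ### Attention sublayers -/

/-- The single-head attention sublayer whose queries, keys and values are given by the matrices
`Aq`, `Ak` and `Av` on slots. -/
noncomputable def slotAttention (K : ℕ) (mask : S → ℚ) (Aq Ak Av : S → S → ℚ) :
    AttentionSublayer 1 (slotDim S) where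
  mask := slotMask mask
  query := fun _ => readMatrix K fun a =>
    if (headCoord.symm a).1 then Aq (headCoord.symm a).2 else 0
  key := fun _ => readMatrix K fun a =>
    if (headCoord.symm a).1 then Ak (headCoord.symm a).2 else 0
  value := fun _ => readMatrix K fun a c =>
    copySign (headCoord.symm a).1 * Av (headCoord.symm a).2 c
  out := 1

/-- The score that a position with residual stream `u` assigns to one with residual stream
`v`. -/
noncomputable def slotScore (mask : S → ℚ) (Aq Ak : S → S → ℚ) (u v : S → ℝ) : ℝ :=
  ∑ a, (∑ c, (Aq a c : ℝ) * normalized mask u c) * ∑ c, (Ak a c : ℝ) * normalized mask v c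

section

variable {n : ℕ} {x : ℕ → Fin n → Fin (1 * slotDim S) → ℝ} {u : Fin n → S → ℝ}

/-- Queries and keys occupy only the positive half of the head, so each slot contributes once to the
score. Values carry both signs, so the output is again antisymmetric. -/
theorem represents_slotAttention_of_maximizers (h : ∀ i, Represents (fun p => x p i) (u i))
    (hrd : IsAsymptoticallyExact rd) (κ : NormKind) {mask : S → ℚ}
    (hu : ∀ i, 0 < ∑ c, (mask c * u i c) ^ 2) {K : ℕ} (hK : Fintype.card S = K ^ 2)
    (Aq Ak Av : S → S → ℚ) {T : Fin n → Finset (Fin n)}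
    (hT : ∀ i, ∀ᶠ p in atTop, maximizers (Finset.Iic i) (fun j => roundedDot (rd p)
      (roundedMulVec (rd p) ((slotAttention K mask Aq Ak Av).query 0)
        (maskedPreNorm κ (rd p) (slotMask mask) (x p i)))
      (roundedMulVec (rd p) ((slotAttention K mask Aq Ak Av).key 0)
        (maskedPreNorm κ (rd p) (slotMask mask) (x p j)))) = T i) (i : Fin n) :
    Represents (fun p => (slotAttention K mask Aq Ak Av).apply κ (rd p) (x p) i)
      fun c => u i c + ∑ j ∈ T i, 1 / ((T i).card : ℝ) *
        ∑ c', (Av c c' : ℝ) * normalized mask (u j) c' := by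
  intro b c
  set z : ℕ → Fin n → Fin (1 * slotDim S) → ℝ := fun p j =>
    maskedPreNorm κ (rd p) (slotMask mask) (x p j) with hz
  have hv : ∀ (j : Fin n) (a : Fin (slotDim S)), Tendsto
      (fun p => roundedMulVec (rd p) ((slotAttention K mask Aq Ak Av).value 0) (z p j) a) atTop
      (𝓝 (copySign (headCoord.symm a).1 *
        ∑ c', (Av (headCoord.symm a).2 c' : ℝ) * normalized mask (u j) c')) := by
    intro j a
    have := (h j).readMatrix hrd κ (hu j) hK (fun (a : Fin (slotDim S)) c =>
      copySign (headCoord.symm a).1 * Av (headCoord.symm a).2 c) a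
    simp only [Rat.cast_mul, mul_assoc, ← Finset.mul_sum] at this
    exact this
  have hhead : ∀ a : Fin (1 * slotDim S), Tendsto (fun p => hardAttention (rd p) (Finset.Iic i)
      (fun j => roundedDot (rd p)
        (roundedMulVec (rd p) ((slotAttention K mask Aq Ak Av).query 0) (z p i))
        (roundedMulVec (rd p) ((slotAttention K mask Aq Ak Av).key 0) (z p j)))
      (fun j => roundedMulVec (rd p) ((slotAttention K mask Aq Ak Av).value 0) (z p j)) a.modNat)
      atTop (𝓝 (∑ j ∈ T i, 1 / ((T i).card : ℝ) * (copySign (headCoord.symm a.modNat).1 *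
        ∑ c', (Av (headCoord.symm a.modNat).2 c' : ℝ) * normalized mask (u j) c'))) :=
    fun a => hrd.hardAttention (hT i) fun j _ => hv j a.modNat
  have hout := hrd.roundedMulVec (1 : Matrix (Fin (1 * slotDim S)) (Fin (1 * slotDim S)) ℚ)
    hhead (coord (b, c))
  rw [Finset.sum_eq_single (coord (b, c)) (fun j _ hj => by simp [hj.symm])
    (by simp)] at hout
  simp only [Matrix.one_apply_eq, Rat.cast_one, one_mul, modNat_coord,
    Equiv.symm_apply_apply] at hout
  have hlim := hrd.tendsto ((h i b c).add hout)
  simp only [mul_left_comm _ (copySign b : ℝ), ← Finset.mul_sum, ← mul_add] at hlim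
  simp only [Finset.mul_sum] at hlim ⊢
  -- There is a single head.
  have hhd : ∀ a : Fin (1 * slotDim S), a.divNat = 0 := fun a => Subsingleton.elim _ _
  refine hlim.congr fun p => ?_
  simp only [AttentionSublayer.apply, hhd]
  rfl

theorem represents_slotAttention_uniform (h : ∀ i, Represents (fun p => x p i) (u i))
    (hrd : IsAsymptoticallyExact rd) (κ : NormKind) {mask : S → ℚ}
    (hu : ∀ i, 0 < ∑ c, (mask c * u i c) ^ 2) {K : ℕ} (hK : Fintype.card S = K ^ 2)
    (Av : S → S → ℚ) (i : Fin n) :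
    Represents (fun p => (slotAttention K mask 0 0 Av).apply κ (rd p) (x p) i)
      fun c => u i c + ∑ j ∈ Finset.Iic i, 1 / ((i : ℝ) + 1) *
        ∑ c', (Av c c' : ℝ) * normalized mask (u j) c' := by
  have hq : (slotAttention K mask (0 : S → S → ℚ) 0 Av).query 0 = 0 := by
    ext a j
    simp [slotAttention, readMatrix]
  have := represents_slotAttention_of_maximizers h hrd κ hu hK 0 0 Av (T := fun i => Finset.Iic i) (fun i =>
    Eventually.of_forall fun p => by
      simp only [hq, hrd.roundedMulVec_zero, hrd.roundedDot_zero_left, maximizers_const]) i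
  simpa using this

theorem represents_slotAttention_unique (h : ∀ i, Represents (fun p => x p i) (u i))
    (hrd : IsAsymptoticallyExact rd) (κ : NormKind) {mask : S → ℚ}
    (hu : ∀ i, 0 < ∑ c, (mask c * u i c) ^ 2) {K : ℕ} (hK : Fintype.card S = K ^ 2)
    (Aq Ak Av : S → S → ℚ) {t : Fin n → Fin n} (hle : ∀ i, t i ≤ i)
    (hmax : ∀ i, ∀ j ≤ i, j ≠ t i →
      slotScore mask Aq Ak (u i) (u j) < slotScore mask Aq Ak (u i) (u (t i))) (i : Fin n) :
    Represents (fun p => (slotAttention K mask Aq Ak Av).apply κ (rd p) (x p) i)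
      fun c => u i c + ∑ c', (Av c c' : ℝ) * normalized mask (u (t i)) c' := by
  have := represents_slotAttention_of_maximizers h hrd κ hu hK Aq Ak Av (T := fun i => {t i}) (fun i => by
    refine eventually_maximizers_eq_singleton (b := fun j => slotScore mask Aq Ak (u i) (u j))
      (fun j _ => ?_) (Finset.mem_Iic.2 (hle i)) fun j hj => hmax i j (Finset.mem_Iic.1 hj)
    have := hrd.roundedDot (fun a => (h i).readMatrix hrd κ (hu i) hK _ a)
      (fun a => (h j).readMatrix hrd κ (hu j) hK _ a)
      (x := fun p => roundedMulVec (rd p) ((slotAttention K mask Aq Ak Av).query 0)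
        (maskedPreNorm κ (rd p) (slotMask mask) (x p i)))
      (y := fun p => roundedMulVec (rd p) ((slotAttention K mask Aq Ak Av).key 0)
        (maskedPreNorm κ (rd p) (slotMask mask) (x p j)))
    convert this using 2
    rw [← headCoord.sum_comp]
    simp [Fintype.sum_prod_type, slotScore]) i
  simpa using this

end

end Antisymmetric

/-! ## Finding an earlier position

The direction of the vector `(1, t)` encodes the position `t`. Among the directions of positions,
the one with the largest inner product with `(1, s)` is that of the position closest to `s`. -/

/-- The first coordinate of the unit vector in direction `(1, t)`. -/
noncomputable def dirX (t : ℝ) : ℝ := 1 / √(1 + t ^ 2)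

/-- The second coordinate of the unit vector in direction `(1, t)`. -/
noncomputable def dirY (t : ℝ) : ℝ := t / √(1 + t ^ 2)

theorem dirX_pos (t : ℝ) : 0 < dirX t := by unfold dirX; positivity

theorem dirY_eq (t : ℝ) : dirY t = t * dirX t := by unfold dirX dirY; ring

theorem dirX_sq_add_dirY_sq (t : ℝ) : dirX t ^ 2 + dirY t ^ 2 = 1 := by
  have h : (0 : ℝ) < 1 + t ^ 2 := by positivity
  unfold dirX dirY
  rw [div_pow, div_pow, Real.sq_sqrt h.le]
  field_simp

/-- This is strict Cauchy–Schwarz for the unit vectors in directions `(1, t)` and `(1, s)`, obtained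
from the Lagrange identity: the squared inner product and the squared determinant sum to `1`, and
the determinant is nonzero when `t ≠ s`. -/
theorem dirX_add_mul_dirY_lt_self {s t : ℝ} (hst : t ≠ s) :
    dirX t + s * dirY t < dirX s + s * dirY s := by
  have hs : dirX s + s * dirY s = 1 / dirX s := by
    rw [eq_div_iff (dirX_pos s).ne', ← dirX_sq_add_dirY_sq s, dirY_eq]
    ring
  rw [hs, lt_div_iff₀ (dirX_pos s)]
  have h1 := dirX_sq_add_dirY_sq s
  have h2 := dirX_sq_add_dirY_sq t
  have hd : dirX t * dirY s - dirY t * dirX s ≠ 0 := by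
    rw [dirY_eq, dirY_eq]
    have : dirX t * (s * dirX s) - t * dirX t * dirX s = dirX t * dirX s * (s - t) := by ring
    rw [this]
    exact mul_ne_zero (mul_pos (dirX_pos t) (dirX_pos s)).ne' (sub_ne_zero.2 hst.symm)
  have hsq := sq_pos_of_ne_zero hd
  have he : (dirX t + s * dirY t) * dirX s = dirX t * dirX s + dirY t * dirY s := by
    rw [dirY_eq s]; ring
  rw [he]
  have hlag : (dirX t * dirX s + dirY t * dirY s) ^ 2 +
      (dirX t * dirY s - dirY t * dirX s) ^ 2 = 1 := by
    have : (dirX t * dirX s + dirY t * dirY s) ^ 2 +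
      (dirX t * dirY s - dirY t * dirX s) ^ 2 =
      (dirX s ^ 2 + dirY s ^ 2) * (dirX t ^ 2 + dirY t ^ 2) := by ring
    rw [this, h1, h2, one_mul]
  exact lt_of_pow_lt_pow_left₀ 2 zero_le_one (by linarith)

/-- A target before the first position is clamped to position `1`: on `t ≥ 1`, `dirX` is decreasing
and `dirY` increasing, and the latter has the coefficient `s ≤ 0`. -/
theorem dirX_add_mul_dirY_lt_one {s t : ℝ} (hs : s ≤ 0) (ht : 1 < t) :
    dirX t + s * dirY t < dirX 1 + s * dirY 1 := by
  have hX : dirX t < dirX 1 := by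
    unfold dirX
    have : (1 : ℝ) + 1 ^ 2 < 1 + t ^ 2 := by nlinarith
    gcongr
  have hY : dirY 1 ≤ dirY t := by
    have h1 := dirX_sq_add_dirY_sq t
    have h2 := dirX_sq_add_dirY_sq 1
    have h3 := dirX_pos t
    have h4 : 0 ≤ dirY t := by rw [dirY_eq]; positivity
    refine le_of_sq_le_sq ?_ h4
    have : dirX t ^ 2 ≤ dirX 1 ^ 2 := by gcongr
    linarith
  have := mul_le_mul_of_nonpos_left hY hs
  linarith

/-- Index `i` has position `i + 1`. The truncated subtraction `i - o` matches the clamping at the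
first position, so both cases have the same form. -/
theorem dirX_add_mul_dirY_lt_sub {i j o : ℕ} (hj : j ≠ i - o) :
    dirX (j + 1) + ((i : ℝ) + 1 - o) * dirY (j + 1) <
      dirX ((i - o : ℕ) + 1) + ((i : ℝ) + 1 - o) * dirY ((i - o : ℕ) + 1) := by
  rcases le_or_gt o i with h | h
  · have hs : (i : ℝ) + 1 - o = (i - o : ℕ) + 1 := by push_cast [h]; ring
    rw [hs]
    exact dirX_add_mul_dirY_lt_self fun hh => hj (by exact_mod_cast add_right_cancel hh)
  · have h0 : i - o = 0 := Nat.sub_eq_zero_of_le h.le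
    rw [h0] at hj ⊢
    have hs : (i : ℝ) + 1 - o ≤ 0 := by
      have : (i : ℝ) + 1 ≤ o := by exact_mod_cast h
      linarith
    have hj1 : (1 : ℝ) < j + 1 := by
      have : (0 : ℝ) < j := by exact_mod_cast Nat.pos_of_ne_zero hj
      linarith
    simpa using dirX_add_mul_dirY_lt_one hs hj1

/-! ## Products over windows -/

/-- The product of `g` over the last `2 ^ l` positions up to `i`, by repeated doubling. Positions
before the first are replaced by the first. -/
def windowProd {M : Type*} [Mul M] (g : ℕ → M) : ℕ → ℕ → M
  | 0, i => g i
  | l + 1, i => windowProd g l i * windowProd g l (i - 2 ^ l)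

/-- The state after reading position `i`, if the state after reading position `0` is `q`. -/
def stateAfter {σ : Type*} (g : ℕ → Function.End σ) (q : σ) : ℕ → σ
  | 0 => q
  | i + 1 => g (i + 1) (stateAfter g q i)

/-- Multiplication is composition with the later half of the window on the left. A window that
reaches position `0` contains the constant map `g 0`, so its product forgets its argument `r`; a
window that does not reach it transports the state across `2 ^ l` steps. The first claim for `l + 1`
uses both claims for `l`. -/
theorem windowProd_apply {σ : Type*} {g : ℕ → Function.End σ} {q : σ} (hg : ∀ r, g 0 r = q)
    (l i : ℕ) : (∀ r, i < 2 ^ l → windowProd g l i r = stateAfter g q i) ∧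
      (2 ^ l ≤ i → windowProd g l i (stateAfter g q (i - 2 ^ l)) = stateAfter g q i) := by
  induction l generalizing i with
  | zero =>
    refine ⟨fun r hi => ?_, fun hi => ?_⟩
    · obtain rfl : i = 0 := by simpa using hi
      exact hg r
    · obtain ⟨i, rfl⟩ := Nat.exists_eq_add_of_le' hi
      rfl
  | succ l ih =>
    have hmul : ∀ r, windowProd g (l + 1) i r =
      windowProd g l i (windowProd g l (i - 2 ^ l) r) := fun r => rfl
    have hpow : 2 ^ (l + 1) = 2 ^ l + 2 ^ l := by ring
    refine ⟨fun r hi => ?_, fun hi => ?_⟩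
    · rw [hmul]
      rcases lt_or_ge i (2 ^ l) with h | h
      · exact (ih i).1 _ h
      · rw [(ih (i - 2 ^ l)).1 _ (by omega)]
        exact (ih i).2 h
    · rw [hmul, hpow, ← Nat.sub_sub, (ih (i - 2 ^ l)).2 (by omega)]
      exact (ih i).2 (by omega)

/-! ## The transformer -/

section Construction

variable {M : Type*} [Fintype M]

/-- The number of slots is the square of this number. -/
abbrev slotRoot (M : Type*) [Fintype M] : ℕ := 5 + 2 * Fintype.card M

/-- The slots of the residual stream: five numbers (whether the position is the first; the
reciprocal of the position; the number one; the two coordinates of the direction of the position),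
two elements of `M` in one-hot encoding, and unused slots that make the dimension suitable. -/
abbrev Slot (M : Type*) [Fintype M] : Type _ :=
  Fin 5 ⊕ M ⊕ M ⊕ Fin (slotRoot M ^ 2 - slotRoot M)

/-- The padding makes the number of slots a perfect square, as `Represents.layerNorm` requires. -/
theorem card_slot : Fintype.card (Slot M) = slotRoot M ^ 2 := by
  have : slotRoot M ≤ slotRoot M ^ 2 := Nat.le_self_pow two_ne_zero _
  simp only [Fintype.card_sum, Fintype.card_fin]
  have : slotRoot M = 5 + 2 * Fintype.card M := rfl
  omega

/-- A vector indexed by slots. -/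
def slotVec {R : Type*} [Zero R] (a : Fin 5 → R) (F G : M → R) : Slot M → R :=
  Sum.elim a (Sum.elim F (Sum.elim G 0))

section

variable {R : Type*} [Zero R] (a : Fin 5 → R) (F G : M → R)

@[simp] theorem slotVec_number (c) : slotVec a F G (.inl c) = a c := rfl
@[simp] theorem slotVec_first (c) : slotVec a F G (.inr (.inl c)) = F c := rfl
@[simp] theorem slotVec_second (c) : slotVec a F G (.inr (.inr (.inl c))) = G c := rfl
@[simp] theorem slotVec_unused (c) : slotVec a F G (.inr (.inr (.inr c))) = 0 := rfl

end

section

variable (m : Fin 5 → ℚ) (mF mG : M → ℚ) (a : Fin 5 → ℝ) (F G : M → ℝ)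

theorem sum_slotVec_mul : ∑ c, ((slotVec m mF mG c : ℚ) : ℝ) * slotVec a F G c =
    ∑ i, (m i : ℝ) * a i + (∑ f, (mF f : ℝ) * F f + ∑ g, (mG g : ℝ) * G g) := by
  simp [Fintype.sum_sum_type]

theorem sum_slotVec_sq : ∑ c, (((slotVec m mF mG c : ℚ) : ℝ) * slotVec a F G c) ^ 2 =
    ∑ i, ((m i : ℝ) * a i) ^ 2 +
      (∑ f, ((mF f : ℝ) * F f) ^ 2 + ∑ g, ((mG g : ℝ) * G g) ^ 2) := by
  simp [Fintype.sum_sum_type]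

theorem normalized_slotVec {ν : ℝ} (hν : √(∑ c, (((slotVec m mF mG c : ℚ) : ℝ) * slotVec a F G c) ^ 2)
    = ν) : normalized (slotVec m mF mG) (slotVec a F G) =
      slotVec (fun i => m i * a i / ν) (fun f => mF f * F f / ν) (fun g => mG g * G g / ν) := by
  funext c
  rw [normalized, hν]
  rcases c with c | c | c | c <;> simp

end

variable [DecidableEq M]

/-- The indicator of the first position, as a sign. -/
def firstSign (i : ℕ) : ℚ := if i = 0 then 1 else -1

/-- The residual stream before the first layer, at a position holding `f`. -/
noncomputable def streamInit (i : ℕ) (f : M) : Slot M → ℝ :=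
  slotVec ![(firstSign i : ℝ), 1 / 2, 1, 0, 0] (Pi.single f 1) 0

/-- The residual stream after the first layer, at a position holding `f` and a second vector
`G`. -/
noncomputable def stream (i : ℕ) (f : M) (G : M → ℝ) : Slot M → ℝ :=
  slotVec ![(firstSign i : ℝ), 1 / ((i : ℝ) + 1), 1, dirX (i + 1), dirY (i + 1)] (Pi.single f 1) G

/-- The neurons of the feedforward sublayers. -/
abbrev Neuron (M : Type*) : Type _ := (M × M) ⊕ Bool

/-- The attention sublayer of the first layer computes the reciprocal of the position. -/
noncomputable def positionAttention (M : Type*) [Fintype M] [DecidableEq M] :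
    AttentionSublayer 1 (slotDim (Slot M)) :=
  slotAttention (slotRoot M) (slotVec ![1, 0, 0, 0, 0] 0 0) 0 0
    (Pi.single (.inl 1) (slotVec ![1 / 2, 0, 0, 0, 0] 0 0))

/-- The feedforward sublayer of the first layer computes the direction of the position. -/
noncomputable def positionFeedforward (M : Type*) [Fintype M] [DecidableEq M] :
    FeedforwardSublayer (1 * slotDim (Slot M)) (Fintype.card (Neuron M)) :=
  slotFeedforward (slotRoot M) (slotVec ![0, 1, 1, 0, 0] 0 0)
    (Sum.elim 0 fun b : Bool => if b then slotVec ![0, 1, 0, 0, 0] 0 0 else slotVec ![0, 0, 1, 0, 0] 0 0)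
    (Sum.elim 0 fun b : Bool => if b then slotVec ![0, 0, 0, 1, 0] 0 0 else slotVec ![0, 0, 0, 0, 1] 0 0)

/-- The attention sublayers of the later layers fetch the element held by the position that is `o`
steps earlier. -/
noncomputable def fetchAttention (M : Type*) [Fintype M] [DecidableEq M] (o : ℕ) :
    AttentionSublayer 1 (slotDim (Slot M)) :=
  slotAttention (slotRoot M) (slotVec ![0, 0, 0, 4, 4] 3 0)
    (Sum.elim ![0, 0, 0, slotVec ![0, 0, 0, 1, 0] 0 0, slotVec ![0, 0, 0, -(o : ℚ), 1] 0 0] 0)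
    (Sum.elim ![0, 0, 0, slotVec ![0, 0, 0, 1, 0] 0 0, slotVec ![0, 0, 0, 0, 1] 0 0] 0)
    (Sum.elim 0 (Sum.elim 0 (Sum.elim (fun g => slotVec 0 (Pi.single g (5 / 3)) 0) 0)))

/-- The feedforward sublayers of the later layers multiply the two elements that a position
holds. -/
noncomputable def multiplyFeedforward (M : Type*) [Fintype M] [DecidableEq M] [Mul M] :
    FeedforwardSublayer (1 * slotDim (Slot M)) (Fintype.card (Neuron M)) :=
  slotFeedforward (slotRoot M) (slotVec 0 3 4)
    (Sum.elim (fun fg => slotVec 0 (Pi.single fg.1 (5 / 3) - 5 / 3) (Pi.single fg.2 (5 / 4))) 0)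
    (Sum.elim (fun fg => slotVec 0 (Pi.single (fg.1 * fg.2) 1 - Pi.single fg.1 1)
      (-Pi.single fg.2 1)) 0)

/-! ### Limiting behaviour of the individual sublayers -/

section Sublayers

variable {rd : ℕ → ℝ → ℝ} {n : ℕ} {x : ℕ → Fin n → Fin (1 * slotDim (Slot M)) → ℝ}

theorem firstSign_sq (i : ℕ) : (firstSign i : ℝ) ^ 2 = 1 := by
  unfold firstSign; split_ifs <;> simp

theorem sum_Iic_firstSign (i : Fin n) :
    ∑ j ∈ Finset.Iic i, (firstSign (j : ℕ) : ℝ) = 1 - i := by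
  have h : ∀ k : ℕ, ∑ j ∈ Finset.range (k + 1), (firstSign j : ℝ) = 1 - k := by
    intro k
    induction k with
    | zero => simp [firstSign]
    | succ k ih =>
      rw [Finset.sum_range_succ, ih]
      simp [firstSign]
      ring
  rw [← h i, Nat.range_succ_eq_Iic, ← Fin.map_valEmbedding_Iic, Finset.sum_map]
  rfl

/-- The signs up to index `i` have average `(1 - i) / (i + 1) = 2 / (i + 1) - 1`. Half of it, added
to the initial `1 / 2`, is `1 / (i + 1)`. -/
theorem represents_positionAttention (hrd : IsAsymptoticallyExact rd) (κ : NormKind) {f : Fin n → M}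
    (h : ∀ i, Represents (fun p => x p i) (streamInit i (f i))) (i : Fin n) :
    Represents (fun p => (positionAttention M).apply κ (rd p) (x p) i)
      (slotVec ![(firstSign i : ℝ), 1 / ((i : ℝ) + 1), 1, 0, 0] (Pi.single (f i) 1) 0) := by
  have hsq : ∀ i : Fin n, ∑ c, ((slotVec ![1, 0, 0, 0, 0] 0 0 c : ℚ) *
      streamInit i (f i) c : ℝ) ^ 2 = 1 := fun i => by
    rw [streamInit, sum_slotVec_sq]
    simp [Fin.sum_univ_five, firstSign_sq]
  have hout := represents_slotAttention_uniform h hrd κ (fun i => by rw [hsq]; exact one_pos)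
    card_slot (Pi.single (.inl 1) (slotVec ![1 / 2, 0, 0, 0, 0] 0 0)) i
  refine Eq.subst (motive := Represents _) ?_ hout
  have hread : ∀ j : Fin n, ∑ c, ((slotVec ![1 / 2, 0, 0, 0, 0] 0 0 c : ℚ) : ℝ) *
      normalized (slotVec ![1, 0, 0, 0, 0] 0 0) (streamInit j (f j)) c = firstSign j / 2 := by
    intro j
    have hν := hsq j
    rw [streamInit] at hν ⊢
    rw [normalized_slotVec _ _ _ _ _ _ (by rw [hν, Real.sqrt_one]), sum_slotVec_mul]
    simp [Fin.sum_univ_five]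
    ring
  funext c
  by_cases hc : c = .inl 1
  · subst hc
    simp only [Pi.single_eq_same, hread, ← Finset.mul_sum, ← Finset.sum_div, sum_Iic_firstSign]
    simp [streamInit]
    field_simp
    ring
  · simp only [Pi.single_eq_of_ne hc]
    rcases c with c | c | c | c <;> simp [streamInit]
    fin_cases c <;> simp at hc ⊢

/-- The vectors `(1 / (i + 1), 1)` and `(1, i + 1)` have the same direction, so normalization yields
`dirX` and `dirY`. Both are nonnegative, and ReLU leaves them unchanged. -/
theorem Represents.positionFeedforward (hrd : IsAsymptoticallyExact rd) (κ : NormKind)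
    {y : ℕ → Fin (1 * slotDim (Slot M)) → ℝ} {i : ℕ} {f : M}
    (h : Represents y (slotVec ![(firstSign i : ℝ), 1 / ((i : ℝ) + 1), 1, 0, 0]
      (Pi.single f 1) 0)) :
    Represents (fun p => (positionFeedforward M).apply κ (rd p) (y p)) (stream i f 0) := by
  have hi : (0 : ℝ) < (i : ℝ) + 1 := by positivity
  have hsq : ∑ c, ((slotVec ![0, 1, 1, 0, 0] 0 0 c : ℚ) *
      slotVec ![(firstSign i : ℝ), 1 / ((i : ℝ) + 1), 1, 0, 0] (Pi.single f 1) 0 c : ℝ) ^ 2 =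
      (1 + ((i : ℝ) + 1) ^ 2) / ((i : ℝ) + 1) ^ 2 := by
    rw [sum_slotVec_sq]
    simp [Fin.sum_univ_five]
    field_simp
  have hout := h.slotFeedforward hrd κ (by rw [hsq]; positivity) card_slot
    (Sum.elim (0 : M × M → Slot M → ℚ) fun b : Bool =>
      if b then slotVec ![0, 1, 0, 0, 0] 0 0 else slotVec ![0, 0, 1, 0, 0] 0 0)
    (Sum.elim (0 : M × M → Slot M → ℚ) fun b : Bool =>
      if b then slotVec ![0, 0, 0, 1, 0] 0 0 else slotVec ![0, 0, 0, 0, 1] 0 0)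
  refine Eq.subst (motive := Represents _) ?_ hout
  rw [normalized_slotVec (ν := √(1 + ((i : ℝ) + 1) ^ 2) / ((i : ℝ) + 1)) _ _ _ _ _ _
    (by rw [hsq, Real.sqrt_div (by positivity), Real.sqrt_sq hi.le])]
  have hd : ∀ a : ℝ, a / (√(1 + ((i : ℝ) + 1) ^ 2) / ((i : ℝ) + 1)) =
      a * ((i : ℝ) + 1) / √(1 + ((i : ℝ) + 1) ^ 2) := fun a => div_div_eq_mul_div _ _ _
  funext c
  rw [Fintype.sum_sum_type, Fintype.sum_bool]
  simp only [Sum.elim_inl, Sum.elim_inr, if_true, Bool.false_eq_true, if_false, sum_slotVec_mul,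
    hd]
  have hY : (0 : ℝ) ≤ ((i : ℝ) + 1) / √(1 + ((i : ℝ) + 1) ^ 2) := by positivity
  rcases c with c | c | c | c
  · fin_cases c <;>
      simp [stream, Fin.sum_univ_five, dirX, dirY, hi.ne', max_eq_right hY]
  all_goals simp [stream]

/-- The direction is a unit vector with weight `4` and the one-hot vector has weight `3`: `4 ^ 2 + 3
^ 2 = 5 ^ 2`, so the norm is rational and independent of the position. -/
theorem sum_sq_stream_fetch (i : ℕ) (f : M) : ∑ c, ((slotVec ![0, 0, 0, 4, 4] 3 0 c : ℚ) *
    stream i f 0 c : ℝ) ^ 2 = 25 := by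
  have h := dirX_sq_add_dirY_sq ((i : ℝ) + 1)
  rw [stream, sum_slotVec_sq]
  simp only [Pi.single_apply]
  simp [Fin.sum_univ_five, mul_pow, ite_pow]
  linarith

theorem normalized_stream_fetch (i : ℕ) (f : M) :
    normalized (slotVec ![0, 0, 0, 4, 4] 3 0) (stream i f 0) =
      slotVec ![0, 0, 0, 4 / 5 * dirX (i + 1), 4 / 5 * dirY (i + 1)] (Pi.single f (3 / 5)) 0 := by
  have hν := sum_sq_stream_fetch i f
  rw [stream] at hν ⊢
  rw [normalized_slotVec (ν := 5) _ _ _ _ _ _ (by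
    rw [hν, show (25 : ℝ) = 5 ^ 2 by norm_num, Real.sqrt_sq (by norm_num)])]
  congr 1
  · funext c
    fin_cases c <;> simp <;> ring
  · funext c
    by_cases hc : c = f
    · subst hc; simp
    · simp [hc]
  · funext c
    simp

/-- The query `(dirX, dirY - o * dirX)` at position `i + 1` is a positive multiple of `(1, i + 1 -
o)`, hence points at the position `o` steps earlier. The factor `5 / 3` in the values undoes the
weight `3 / 5` left by normalization. -/
theorem represents_fetchAttention (hrd : IsAsymptoticallyExact rd) (κ : NormKind) {f : ℕ → M}
    (h : ∀ i : Fin n, Represents (fun p => x p i) (stream i (f i) 0)) (o : ℕ) (i : Fin n) :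
    Represents (fun p => (fetchAttention M o).apply κ (rd p) (x p) i)
      (stream i (f i) (Pi.single (f (i - o)) 1)) := by
  have hlt : ∀ i : Fin n, (i : ℕ) - o < n := fun i => (Nat.sub_le _ _).trans_lt i.isLt
  have hout := represents_slotAttention_unique (t := fun i => ⟨i - o, hlt i⟩) h hrd κ
    (fun i => by rw [sum_sq_stream_fetch]; norm_num) card_slot
    (Sum.elim ![0, 0, 0, slotVec ![0, 0, 0, 1, 0] 0 0, slotVec ![0, 0, 0, -(o : ℚ), 1] 0 0] 0)
    (Sum.elim ![0, 0, 0, slotVec ![0, 0, 0, 1, 0] 0 0, slotVec ![0, 0, 0, 0, 1] 0 0] 0)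
    (Sum.elim 0 (Sum.elim 0 (Sum.elim (fun g => slotVec 0 (Pi.single g (5 / 3)) 0) 0)))
    (fun i => Nat.sub_le _ _) (fun i j _ hj => ?_) i
  · refine Eq.subst (motive := Represents _) ?_ hout
    funext c
    rw [normalized_stream_fetch]
    rcases c with c | c | c | c
    · simp [stream]
    · simp [stream]
    · simp only [Sum.elim_inr, Sum.elim_inl, sum_slotVec_mul]
      simp only [stream, slotVec_second, Pi.single_apply]
      by_cases hc : c = f (i - o)
      · simp [hc]
      · simp [hc, Ne.symm hc]
    · simp [stream]
  -- Query and key each carry a factor `4 / 5` from normalization.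
  · have hscore : ∀ k : Fin n, slotScore (slotVec ![0, 0, 0, 4, 4] 3 0)
        (Sum.elim ![0, 0, 0, slotVec ![0, 0, 0, 1, 0] 0 0, slotVec ![0, 0, 0, -(o : ℚ), 1] 0 0] 0)
        (Sum.elim ![0, 0, 0, slotVec ![0, 0, 0, 1, 0] 0 0, slotVec ![0, 0, 0, 0, 1] 0 0] 0)
        (stream i (f i) 0) (stream k (f k) 0) = 16 / 25 * dirX (i + 1) *
          (dirX (k + 1) + ((i : ℝ) + 1 - o) * dirY (k + 1)) := by
      intro k
      rw [slotScore, Fintype.sum_sum_type]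
      simp only [normalized_stream_fetch, Sum.elim_inl, Sum.elim_inr, Fin.sum_univ_five,
        Matrix.cons_val, sum_slotVec_mul]
      simp
      rw [dirY_eq ((i : ℝ) + 1)]
      ring
    rw [hscore, hscore]
    refine mul_lt_mul_of_pos_left ?_ (mul_pos (by norm_num) (dirX_pos _))
    exact dirX_add_mul_dirY_lt_sub fun hh => hj (Fin.ext hh)

theorem sum_sq_stream_multiply (i : ℕ) (f g : M) : ∑ c, ((slotVec 0 3 4 c : ℚ) *
    stream i f (Pi.single g 1) c : ℝ) ^ 2 = 25 := by
  rw [stream, sum_slotVec_sq]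
  simp only [Pi.single_apply]
  simp [ite_pow]
  norm_num

theorem normalized_stream_multiply (i : ℕ) (f g : M) :
    normalized (slotVec 0 3 4) (stream i f (Pi.single g 1)) =
      slotVec 0 (Pi.single f (3 / 5)) (Pi.single g (4 / 5)) := by
  have hν := sum_sq_stream_multiply i f g
  rw [stream] at hν ⊢
  rw [normalized_slotVec (ν := 5) _ _ _ _ _ _ (by
    rw [hν, show (25 : ℝ) = 5 ^ 2 by norm_num, Real.sqrt_sq (by norm_num)])]
  congr 1
  · funext c
    simp
  · funext c
    by_cases hc : c = f
    · subst hc; simp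
    · simp [hc]
  · funext c
    by_cases hc : c = g
    · subst hc; simp
    · simp [hc]

/-- One neuron per pair detects the pair `(f, g)`. It writes `f * g` in place of `f` and erases `g`,
which restores an empty second vector for the next fetch. -/
theorem Represents.multiplyFeedforward [Mul M] (hrd : IsAsymptoticallyExact rd) (κ : NormKind)
    {y : ℕ → Fin (1 * slotDim (Slot M)) → ℝ} {i : ℕ} {f g : M}
    (h : Represents y (stream i f (Pi.single g 1))) :
    Represents (fun p => (multiplyFeedforward M).apply κ (rd p) (y p)) (stream i (f * g) 0) := by
  have hout := h.slotFeedforward hrd κ (by rw [sum_sq_stream_multiply]; norm_num) card_slot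
    (Sum.elim (fun fg => slotVec 0 (Pi.single fg.1 (5 / 3) - 5 / 3) (Pi.single fg.2 (5 / 4))) 0 :
      Neuron M → Slot M → ℚ)
    (Sum.elim (fun fg => slotVec 0 (Pi.single (fg.1 * fg.2) 1 - Pi.single fg.1 1)
      (-Pi.single fg.2 1)) 0)
  refine Eq.subst (motive := Represents _) ?_ hout
  -- The preactivation is `[f' = f] + [g' = g] - 1`, whose positive part is the conjunction; `5 / 3`
  -- and `5 / 4` rescale the normalized entries `3 / 5` and `4 / 5` to `1`.
  have hgate : ∀ fg : M × M, max 0 (∑ c, ((slotVec 0 (Pi.single fg.1 (5 / 3) - 5 / 3)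
      (Pi.single fg.2 (5 / 4)) c : ℚ) : ℝ) *
      normalized (slotVec 0 3 4) (stream i f (Pi.single g 1)) c) =
        if fg = (f, g) then 1 else 0 := by
    rintro ⟨f', g'⟩
    rw [normalized_stream_multiply, sum_slotVec_mul]
    have hF : ∑ c, ((Pi.single f' (5 / 3) - 5 / 3 : M → ℚ) c : ℝ) *
        (Pi.single f (3 / 5) : M → ℝ) c =
        (if f' = f then 1 else 0) - 1 := by
      rw [Finset.sum_eq_single f (fun c _ hc => by simp [hc]) (by simp)]
      by_cases hf : f' = f
      · simp [hf]
      · simp [hf, Ne.symm hf]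
    have hG : ∑ c, ((Pi.single g' (5 / 4) : M → ℚ) c : ℝ) *
        (Pi.single g (4 / 5) : M → ℝ) c =
        if g' = g then 1 else 0 := by
      rw [Finset.sum_eq_single g (fun c _ hc => by simp [hc]) (by simp)]
      by_cases hg : g' = g
      · simp [hg]
      · simp [hg, Ne.symm hg]
    rw [hF, hG]
    simp only [Prod.mk.injEq]
    by_cases hf : f' = f <;> by_cases hg : g' = g <;> simp [hf, hg]
  funext c
  rw [Fintype.sum_sum_type]
  simp only [Sum.elim_inl, Sum.elim_inr, hgate]
  simp only [mul_ite, mul_one, mul_zero, Finset.sum_ite_eq', Finset.mem_univ, if_true]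
  rcases c with c | c | c | c
  · simp [stream]
  · simp only [stream, slotVec_first, Pi.single_apply, Pi.sub_apply]
    split_ifs <;> simp
  · simp only [stream, slotVec_second, Pi.single_apply, Pi.neg_apply]
    split_ifs <;> simp
  · simp [stream]

end Sublayers

end Construction

/-- The invariant concerns a whole sequence of states indexed by the precision, because `Represents`
is a statement about a limit. -/
theorem foldl_finRange_invariant {d : ℕ} {X : Type*} (f : ℕ → Fin d → X → X)
    (P : ℕ → (ℕ → X) → Prop) {s : ℕ → X} (h0 : P 0 s)
    (hstep : ∀ (l : Fin d) (s : ℕ → X), P l s → P (l + 1) fun p => f p l (s p)) :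
    P d fun p => (List.finRange d).foldl (fun h l => f p l h) (s p) := by
  have key : ∀ k ≤ d, P k fun p => ((List.finRange d).take k).foldl (fun h l => f p l h) (s p) := by
    intro k
    induction k with
    | zero => intro _; simpa using h0
    | succ k ih =>
      intro hk
      have := hstep ⟨k, hk⟩ _ (ih (Nat.le_of_succ_le hk))
      simpa [List.take_add_one, List.getElem?_eq_getElem, Nat.lt_of_succ_le hk] using this
  have h := key d le_rfl
  rwa [List.take_of_length_le (by simp)] at h

/-! ### Composition of the layers -/

section Construction

variable {M : Type*} [Fintype M] [DecidableEq M] [Mul M]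

/-- The attention sublayer of each layer. -/
noncomputable def layerAttention (M : Type*) [Fintype M] [DecidableEq M] :
    ℕ → AttentionSublayer 1 (slotDim (Slot M))
  | 0 => positionAttention M
  | l + 1 => fetchAttention M (2 ^ l)

/-- The feedforward sublayer of each layer. -/
noncomputable def layerFeedforward (M : Type*) [Fintype M] [DecidableEq M] [Mul M] :
    ℕ → FeedforwardSublayer (1 * slotDim (Slot M)) (Fintype.card (Neuron M))
  | 0 => positionFeedforward M
  | _ + 1 => multiplyFeedforward M

/-- The transformer that multiplies the values of its input tokens, as elements of `M`: after a
first layer that computes directions of positions, each layer doubles the number of factors. The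
logits are then read off from the product. -/
noncomputable def productTransformer {V : Type*} (value : V → M) (sign : V → ℚ)
    (score : V → M → ℚ) (d : ℕ) : Transformer V d where
  heads := 1
  heads_pos := one_pos
  headDim := slotDim (Slot M)
  width := Fintype.card (Neuron M)
  embed y j := copySign (coord.symm j).1 *
    slotVec ![sign y, 1 / 2, 1, 0, 0] (Pi.single (value y) 1) 0 (coord.symm j).2
  pos := 0
  attn l := layerAttention M l
  ff l := layerFeedforward M l
  unembed y j := if (coord.symm j).1 then slotVec 0 (score y) 0 (coord.symm j).2 else 0

/-- The residual stream after `l` layers at position `i`, if position `i` initially holds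
`g i`. -/
noncomputable def streamAt (g : ℕ → M) : ℕ → ℕ → Slot M → ℝ
  | 0, i => streamInit i (g i)
  | l + 1, i => stream i (windowProd g l i) 0

section

variable {rd : ℕ → ℝ → ℝ} {n d : ℕ} {V : Type*} {value : V → M} {sign : V → ℚ}
  {score : V → M → ℚ} {x : Fin n → V} {g : ℕ → M}

theorem represents_productTransformer_initial (hrd : IsAsymptoticallyExact rd)
    (hg : ∀ i, value (x i) = g i) (hs : ∀ i, sign (x i) = firstSign i) (i : Fin n) :
    Represents (fun p => (productTransformer value sign score d).initial (rd p) x i)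
      (streamAt g 0 i) := by
  intro b c
  have h := hrd.tendsto ((hrd.const
    ((productTransformer value sign score d).embed (x i) (coord (b, c)) : ℝ)).add (hrd.const 0))
  have hc : ((slotVec ![firstSign i, 1 / 2, 1, 0, 0] (Pi.single (g i) 1) 0 c : ℚ) : ℝ) =
      streamAt g 0 i c := by
    rcases c with c | c | c | c
    · fin_cases c <;> simp [streamAt, streamInit]
    · by_cases hc : c = g i <;> simp [streamAt, streamInit, hc]
    · simp [streamAt, streamInit]
    · simp [streamAt, streamInit]
  simp only [productTransformer, Equiv.symm_apply_apply, hs, hg, Rat.cast_mul, hc,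
    add_zero] at h
  refine h.congr fun p => ?_
  simp only [Transformer.initial, productTransformer, Equiv.symm_apply_apply, hs, hg,
    Rat.cast_mul, hc, Pi.zero_apply, Rat.cast_zero]

theorem represents_productTransformer_layer (hrd : IsAsymptoticallyExact rd) (κ : NormKind)
    (l : Fin d) {s : ℕ → Fin n → Fin (1 * slotDim (Slot M)) → ℝ}
    (h : ∀ i : Fin n, Represents (fun p => s p i) (streamAt g l i)) (i : Fin n) :
    Represents (fun p => (productTransformer value sign score d).layer κ (rd p) l (s p) i)
      (streamAt g (l + 1) i) := by
  change Represents (fun p => (layerFeedforward M l).apply κ (rd p)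
    ((layerAttention M l).apply κ (rd p) (s p) i)) _
  obtain ⟨l, hl⟩ := l
  cases l with
  | zero => exact (represents_positionAttention hrd κ h i).positionFeedforward hrd κ
  | succ l => exact (represents_fetchAttention hrd κ h (2 ^ l) i).multiplyFeedforward hrd κ

end

theorem tendsto_productTransformer_logits {rd : ℕ → ℝ → ℝ} (hrd : IsAsymptoticallyExact rd)
    (κ : NormKind) {n d : ℕ} {V : Type*} {value : V → M} {sign : V → ℚ} {score : V → M → ℚ}
    {x : Fin (n + 1) → V} {g : ℕ → M} (hg : ∀ i, value (x i) = g i)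
    (hs : ∀ i, sign (x i) = firstSign i) (y : V) :
    Tendsto (fun p => (productTransformer value sign score d).logits κ (rd p) x y) atTop
      (𝓝 (score y (windowProd g (d - 1) n) : ℝ)) := by
  have hres := foldl_finRange_invariant (d := d)
    (fun p l => (productTransformer value sign score d).layer κ (rd p) l (n := n + 1))
    (fun l s => ∀ i : Fin (n + 1), Represents (fun p => s p i) (streamAt g l i))
    (s := fun p => (productTransformer value sign score d).initial (rd p) x)
    (represents_productTransformer_initial hrd hg hs)
    (fun l s h => represents_productTransformer_layer hrd κ l h) (Fin.last n)
  have h := hrd.roundedDot hres.tendsto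
    (fun j => hrd.const ((productTransformer value sign score d).unembed y j : ℝ))
  refine Eq.subst (motive := fun L => Tendsto _ atTop (𝓝 L)) ?_ h
  refine (sum_coord (S := Slot M) fun b c => (copySign b : ℝ) * streamAt g d (Fin.last n : ℕ) c *
    ((if b then slotVec 0 (score y) 0 c else 0 : ℚ) : ℝ)).trans ?_
  simp only [copySign, if_true, Bool.false_eq_true, if_false, Rat.cast_zero, mul_zero,
    Finset.sum_const_zero, add_zero, Rat.cast_one, one_mul, Fin.val_last]
  simp only [mul_comm (streamAt g d n _)]
  -- For `d = 0` the logits read the initial stream, which also holds the window product of level `0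
  -- = d - 1`.
  rcases d with _ | d
  · rw [streamAt, streamInit, sum_slotVec_mul]
    simp [windowProd, Pi.single_apply]
  · rw [streamAt, stream, sum_slotVec_mul]
    simp [Pi.single_apply]

end Construction

/-! ## Recognizing regular languages -/

section Automaton

variable {α σ : Type*}

/-- The effect of a token on the states of an automaton. The end marker resets to the initial
state if `reset` holds. -/
def DFA.tokenAction (A : DFA α σ) (reset : Prop) [Decidable reset] : Token α → Function.End σ
  | .sym a => fun q => A.step q a
  | .bos => fun _ => A.start
  | .eos => if reset then fun _ => A.start else id
  | .accept => id

/-- The tokens of the input for the string `w`, followed by dummies. -/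
def inputStream (w : List α) (i : ℕ) : Token α :=
  (Token.bos :: (w.map Token.sym ++ [Token.eos]))[i]?.getD .accept

theorem inputTokens_eq (w : List α) (i : Fin (w.length + 2)) :
    inputTokens w i = inputStream w i := by
  simp only [inputTokens, inputStream, List.get_eq_getElem, Fin.val_cast]
  rw [List.getElem?_eq_getElem (by simp; omega), Option.getD_some]

theorem inputStream_last (w : List α) : inputStream w (w.length + 1) = .eos := by
  simp [inputStream]

theorem DFA.stateAfter_tokenAction (A : DFA α σ) (reset : Prop) [Decidable reset] (w : List α)
    {i : ℕ} (hi : i ≤ w.length) :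
    stateAfter (fun i => A.tokenAction reset (inputStream w i)) A.start i = A.eval (w.take i) := by
  induction i with
  | zero => rfl
  | succ i ih =>
    have hi' : i < w.length := hi
    rw [stateAfter, ih hi'.le]
    have : inputStream w (i + 1) = .sym w[i] := by
      simp [inputStream, List.getElem?_append, hi']
    simp only [this, DFA.tokenAction]
    rw [List.take_succ_eq_append_getElem hi', A.eval_append_singleton]

/-- For `2 ≤ d` the window reaches BoS and the end marker must act trivially. For `d < 2` the window
consists of the end marker alone; as `w` is then empty, resetting to the initial state gives the
right answer. -/
theorem DFA.windowProd_tokenAction (A : DFA α σ) {d : ℕ} {w : List α}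
    (hw : (d < 2 ∧ w = []) ∨ (2 ≤ d ∧ w.length + 1 < 2 ^ (d - 1))) :
    windowProd (fun i => A.tokenAction (d < 2) (inputStream w i)) (d - 1) (w.length + 1) A.start =
      A.eval w := by
  rcases hw with ⟨hd, rfl⟩ | ⟨hd, hw⟩
  · have h0 : d - 1 = 0 := by omega
    rw [h0]
    simp [windowProd, inputStream, DFA.tokenAction, hd]
  · rw [(windowProd_apply (q := A.start) (fun r => rfl) _ _).1 _ hw, stateAfter,
      A.stateAfter_tokenAction _ _ le_rfl, List.take_length, inputStream_last]
    simp [DFA.tokenAction, not_lt.2 hd]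

end Automaton

/-- The bound leaves ample slack, since `d - 1` doublings reach back `2 ^ (d - 1)` positions. For `d
< 2` the exponent is negative, which leaves only the empty string. -/
theorem length_bound {d n : ℕ} (h : ((n + 1 : ℕ) : ℝ) ≤ (2 : ℝ) ^ (((d : ℝ) - 9) / 4) + 1) :
    (d < 2 ∧ n = 0) ∨ (2 ≤ d ∧ n + 1 < 2 ^ (d - 1)) := by
  have hn : (n : ℝ) ≤ (2 : ℝ) ^ (((d : ℝ) - 9) / 4) := by push_cast at h; linarith
  rcases lt_or_ge d 2 with hd | hd
  · refine Or.inl ⟨hd, ?_⟩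
    have hd' : (d : ℝ) < 2 := by exact_mod_cast hd
    have : (2 : ℝ) ^ (((d : ℝ) - 9) / 4) < 1 :=
      Real.rpow_lt_one_of_one_lt_of_neg one_lt_two (by linarith)
    have : (n : ℝ) < 1 := hn.trans_lt this
    exact Nat.lt_one_iff.1 (by exact_mod_cast this)
  · refine Or.inr ⟨hd, ?_⟩
    obtain ⟨k, rfl⟩ := Nat.exists_eq_add_of_le' hd
    -- With `d = k + 2` this gives `n ≤ 2 ^ k / 2`, hence `n + 1 < 2 ^ (k + 1)`.
    have hexp : (((k + 2 : ℕ) : ℝ) - 9) / 4 ≤ (k : ℝ) - 1 := by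
      have : (0 : ℝ) ≤ k := k.cast_nonneg
      push_cast
      linarith
    have hle := hn.trans (Real.rpow_le_rpow_of_exponent_le one_le_two hexp)
    rw [Real.rpow_sub two_pos, Real.rpow_natCast, Real.rpow_one] at hle
    have h1 : (1 : ℝ) ≤ 2 ^ k := one_le_pow₀ one_le_two
    have : ((n + 1 : ℕ) : ℝ) < ((2 ^ (k + 2 - 1) : ℕ) : ℝ) := by
      rw [show k + 2 - 1 = k + 1 by omega]
      push_cast
      rw [pow_succ]
      linarith
    exact_mod_cast this

instance Token.instFinite {α : Type*} [Finite α] : Finite (Token α) :=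
  Finite.of_surjective (fun s : α ⊕ Fin 3 => s.elim Token.sym ![.eos, .bos, .accept]) fun t => by
    cases t with
    | sym a => exact ⟨.inl a, rfl⟩
    | eos => exact ⟨.inr 0, rfl⟩
    | bos => exact ⟨.inr 1, rfl⟩
    | accept => exact ⟨.inr 2, rfl⟩

/-! ### Reading off the answer -/

section Recognizer

open Classical in
/-- The score of an answer token, given the effect of the input on the states of an automaton. -/
noncomputable def DFA.answerScore {α σ : Type*} (A : DFA α σ) :
    Token α → Function.End σ → ℚ
  | .accept, f => if f A.start ∈ A.accept then 1 else 0
  | .eos, f => if f A.start ∈ A.accept then 0 else 1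
  | _, _ => 0

/-- The sign that marks the beginning-of-sequence token. -/
def bosSign {α : Type*} : Token α → ℚ
  | .bos => 1
  | _ => -1

theorem bosSign_inputTokens {α : Type*} (w : List α) (i : Fin (w.length + 2)) :
    bosSign (inputTokens w i) = firstSign i := by
  rw [inputTokens_eq]
  obtain ⟨i, hi⟩ := i
  cases i with
  | zero => rfl
  | succ i =>
    rcases lt_or_ge i w.length with h | h
    · simp [inputStream, List.getElem?_append, h, bosSign, firstSign]
    · obtain rfl : i = w.length := by omega
      simp [inputStream_last, bosSign, firstSign]

variable {α σ : Type*} [Finite α] [Fintype (Function.End σ)] [DecidableEq (Function.End σ)]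

/-- The transformer that simulates an automaton. -/
noncomputable def DFA.transformer (A : DFA α σ) (d : ℕ) : Transformer (Token α) d :=
  productTransformer (A.tokenAction (d < 2)) bosSign A.answerScore d

/-- The limiting logits are `1` for the correct answer token (`accept`, or `eos` for rejection) and
`0` for all others. The vocabulary is finite, so this strict gap holds simultaneously for all tokens
once `p` is large. -/
theorem DFA.eventually_recognizesOn (A : DFA α σ) {d : ℕ} {w : List α}
    (hw : ((w.length + 1 : ℕ) : ℝ) ≤ (2 : ℝ) ^ (((d : ℝ) - 9) / 4) + 1) (κ : NormKind)
    {rd : ℕ → ℝ → ℝ} (hrd : IsAsymptoticallyExact rd) :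
    ∀ᶠ p in atTop, (A.transformer d).RecognizesOn κ (rd p) A.accepts w := by
  have hlim := tendsto_productTransformer_logits hrd κ (d := d) (score := A.answerScore)
    (value := A.tokenAction (d < 2)) (x := inputTokens w)
    (g := fun i => A.tokenAction (d < 2) (inputStream w i))
    (fun i => by rw [inputTokens_eq]) (bosSign_inputTokens w)
  set m := windowProd (fun i => A.tokenAction (d < 2) (inputStream w i)) (d - 1) (w.length + 1)
  have hm : m A.start = A.eval w := A.windowProd_tokenAction <|
    (length_bound hw).imp_left fun h => ⟨h.1, List.length_eq_zero_iff.1 h.2⟩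
  have hout : ∀ y, (∀ y', y' ≠ y → A.answerScore y' m < A.answerScore y m) →
      ∀ᶠ p in atTop, (A.transformer d).Outputs κ (rd p) (inputTokens w) y := by
    intro y hy
    refine eventually_all.2 fun y' => ?_
    by_cases h : y' = y
    · simp [h]
    · filter_upwards [(hlim y').eventually_lt (hlim y) (by exact_mod_cast hy y' h)] with p hp _
      exact hp
  by_cases hacc : A.eval w ∈ A.accept
  · filter_upwards [hout .accept fun y' hy' => by
      cases y' <;> simp_all [DFA.answerScore]] with p hp
    exact ⟨.accept, hp, by simpa [DFA.mem_accepts] using hacc⟩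
  · filter_upwards [hout .eos fun y' hy' => by
      cases y' <;> simp_all [DFA.answerScore]] with p hp
    exact ⟨.eos, hp, by simpa [DFA.mem_accepts] using hacc⟩

end Recognizer

theorem mainTheorem5 {α : Type*} [Fintype α] (L : Language α) (hL : L.IsRegular)
    (κ : NormKind) (d : ℕ) :
    ∃ T : Transformer (Token α) d,
      (∀ i, T.pos i = 0) ∧
      (∀ w : List α, ((w.length + 1 : ℕ) : ℝ) ≤ (2 : ℝ) ^ (((d : ℝ) - 9) / 4) + 1 →
        T.RecognizesOn κ id L w) ∧
      (∀ D : BitSemantics, D.IsAdequate →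
        ∃ c : ℝ, 0 < c ∧
          ∀ w : List α, ((w.length + 1 : ℕ) : ℝ) ≤ (2 : ℝ) ^ (((d : ℝ) - 9) / 4) + 1 →
            ∀ p : ℕ, c * Real.logb 2 ((w.length + 2 : ℕ) : ℝ) ≤ (p : ℝ) →
              T.RecognizesOn κ (D.round p) L w) := by
  classical
  obtain ⟨σ, _, A, rfl⟩ := hL
  have : Fintype (Function.End σ) := (inferInstance : Fintype (σ → σ))
  refine ⟨A.transformer d, fun _ => rfl, fun w hw => ?_, fun D hD => ?_⟩
  -- The sequence of rounding functions is constant, so validity at a single index is the exact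
  -- statement.
  · obtain ⟨_, h⟩ := (A.eventually_recognizesOn hw κ isAsymptoticallyExact_id).exists
    exact h
  · set W := {w : List α | ((w.length + 1 : ℕ) : ℝ) ≤ (2 : ℝ) ^ (((d : ℝ) - 9) / 4) + 1}
    have hW : W.Finite := by
      refine (List.finite_length_le α ⌊(2 : ℝ) ^ (((d : ℝ) - 9) / 4) + 1⌋₊).subset fun w hw => ?_
      exact (Nat.le_succ _).trans (Nat.le_floor hw)
    -- Finiteness of `W` gives one threshold `p₀` for all admissible strings. The constant `p₀ + 1`
    -- is positive and, since the logarithm is at least `1`, forces `p₀ ≤ p`.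
    obtain ⟨p₀, hp₀⟩ := eventually_atTop.1 ((eventually_all_finite hW).2 fun w hw =>
      A.eventually_recognizesOn hw κ hD.isAsymptoticallyExact)
    refine ⟨p₀ + 1, by positivity, fun w hw p hp => hp₀ p ?_ w hw⟩
    have hlog : 1 ≤ Real.logb 2 ((w.length + 2 : ℕ) : ℝ) := by
      rw [Real.le_logb_iff_rpow_le one_lt_two (by positivity), Real.rpow_one]
      push_cast
      linarith [w.length.cast_nonneg (α := ℝ)]
    have : (p₀ : ℝ) ≤ p := by nlinarith [p₀.cast_nonneg (α := ℝ)]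
    exact_mod_cast this
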